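/- Let $\mathcal A,\mathcal D$ be finite alphabets and let $X\subseteq\mathcal A^{\mathbb Z}$, $Y\subseteq\mathcal D^{\mathbb Z}$ be shift spaces (closed shift-invariant sets), with languages $\mathcal B(X)=\bigcup_n\mathcal B_n(X)$ and $\mathcal B(Y)=\bigcup_n\mathcal B_n(Y)$, where $\mathcal B_n$ denotes the set of words of length $n$ occurring in points of the shift space. A shift space $Z$ is irreducible if for all $u,v\in\mathcal B(Z)$ there is $w\in\mathcal B(Z)$ with $uwv\in\mathcal B(Z)$. It is synchronized if it is irreducible and has a synchronizing word, that is, some $v\in\mathcal B(Z)$ such that $uv,vw\in\mathcal B(Z)$ implies $uvw\in\mathcal B(Z)$. A code $\phi:X\to Y$ is a map of the form $\phi(x)_i=\Phi(x_{[i-m,i+n]})$ for some $m,n\in\mathbb Z$ with $-m\le n$ and some $\Phi:\mathcal B_{m+n+1}(X)\to\mathcal D$. It is semi-open if for each $l\in\mathbb N$ there is $k\in\mathbb N$ such that for every $u\in\mathcal B_{2l+1}(X)$ there is $v\in\mathcal B_{2k+1}(Y)$ with $\{y\in Y: y_{[-k,k]}=v\}\subseteq\phi(\{x\in X: x_{[-l,l]}=u\})$.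 Theorem. Suppose $X$ is synchronized and $\phi:X\to Y$ is a semi-open code, where $\phi$ is onto or $Y$ is irreducible. Then $Y$ is synchronized. Consequently, a code from a synchronized system onto a non-synchronized shift space is never semi-open. -/

import Mathlib

open SymbolicDynamics.FullShift

namespace Shift

/-- The block `x_{[i, i+n-1]}` of length `n` of a bi-infinite sequence `x`, read from position `i`. -/
def block {A : Type*} (x : ℤ → A) (i : ℤ) (n : ℕ) : List A :=
  List.ofFn fun j : Fin n => x (i + ((j : ℕ) : ℤ))

/-- `B_n(X)`: the words of length `n` that occur in points of the shift space `X`. -/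
def words {A : Type*} [TopologicalSpace A] (X : Subshift A ℤ) (n : ℕ) : Set (List A) :=
  {w | ∃ x ∈ X.carrier, ∃ i : ℤ, block x i n = w}

/-- The language `B(X)`, the union of all `B_n(X)`. -/
def language {A : Type*} [TopologicalSpace A] (X : Subshift A ℤ) : Set (List A) :=
  ⋃ n : ℕ, words X n

theorem block_mem_words {A : Type*} [TopologicalSpace A] (X : Subshift A ℤ) (x : X.carrier)
    (i : ℤ) (n : ℕ) : block (x : ℤ → A) i n ∈ words X n :=
  ⟨x, x.2, i, rfl⟩

/-- `X` is irreducible: any two words of `X` can be joined by a word inside `X`. -/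
def IsIrreducible {A : Type*} [TopologicalSpace A] (X : Subshift A ℤ) : Prop :=
  ∀ u ∈ language X, ∀ v ∈ language X, ∃ w ∈ language X, u ++ w ++ v ∈ language X

/-- `v` is a synchronizing word of `X`. -/
def IsSynchronizing {A : Type*} [TopologicalSpace A] (X : Subshift A ℤ) (v : List A) : Prop :=
  v ∈ language X ∧
    ∀ u w : List A, u ++ v ∈ language X → v ++ w ∈ language X → u ++ v ++ w ∈ language X

/-- A synchronized system: an irreducible shift space with a synchronizing word. -/
def IsSynchronized {A : Type*} [TopologicalSpace A] (X : Subshift A ℤ) : Prop :=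
  IsIrreducible X ∧ ∃ v : List A, IsSynchronizing X v

/-- `φ : X → Y` is a code: it is induced by a block map `Φ : B_{m+n+1}(X) → D`, with `-m ≤ n`,
through `φ(x)_i = Φ(x_{[i-m, i+n]})`. -/
def IsCode {A D : Type*} [TopologicalSpace A] [TopologicalSpace D]
    {X : Subshift A ℤ} {Y : Subshift D ℤ} (φ : X.carrier → Y.carrier) : Prop :=
  ∃ m n : ℤ, -m ≤ n ∧ ∃ Φ : words X (m + n + 1).toNat → D,
    ∀ (x : X.carrier) (i : ℤ),
      (φ x : ℤ → D) i =
        Φ ⟨block (x : ℤ → A) (i - m) (m + n + 1).toNat, block_mem_words X x _ _⟩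

/-- The central `2l+1` cylinder of a word `u` of length `2l+1`: the points `x` of `X` with
`x_{[-l, l]} = u`. -/
def centralCylinder {A : Type*} [TopologicalSpace A] (X : Subshift A ℤ) (l : ℕ) (u : List A) :
    Set X.carrier :=
  {x | block (x : ℤ → A) (-(l : ℤ)) (2 * l + 1) = u}

/-- `φ : X → Y` is semi-open: for each `l` there is `k` such that the image of every (nonempty)
central `2l+1` cylinder of `X` contains a (nonempty) central `2k+1` cylinder of `Y`. -/
def IsSemiOpen {A D : Type*} [TopologicalSpace A] [TopologicalSpace D]
    {X : Subshift A ℤ} {Y : Subshift D ℤ} (φ : X.carrier → Y.carrier) : Prop :=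
  ∀ l : ℕ, ∃ k : ℕ, ∀ u ∈ words X (2 * l + 1), ∃ v ∈ words Y (2 * k + 1),
    centralCylinder Y k v ⊆ φ '' centralCylinder X l u

end Shift

/-!
A synchronizing word `s` of `X` allows two points of `X` that both carry `s` at the same position to
be spliced there: the left half of the one followed by the right half of the other is again a point
of `X`, because all its blocks around `s` are words of `X` and `X` is closed
(`Shift.IsSynchronizing.splice_mem`).

Prolong `s` to a word `u` of length `2 * l + 1` with `l` larger than the window of the code `φ`, and
let `v` be a word of `Y` whose central cylinder lies in the image of the central cylinder of `u`.
Then `v` is synchronizing (`Shift.isSynchronizing_of_centralCylinder_subset`): two points of `Y`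
that carry `v` in the centre have preimages carrying `u` in the centre. Splice these preimages. Since
`u` covers the window, each coordinate of the image of the spliced point is determined either by the
first preimage alone or by the second alone, where both choices are available around the origin; so
the image follows the first point of `Y` up to `v` and the second one from `v` on.

Irreducibility of `Y`, if it is not assumed, is inherited from `X` through the surjection
(`Shift.IsIrreducible.of_surjective`).
-/

namespace Shift

/-! ### Blocks and languages -/

section Blocks

variable {A : Type*}

@[simp]
theorem length_block (x : ℤ → A) (i : ℤ) (n : ℕ) : (block x i n).length = n := by
  simp [block]

theorem block_eq_block_iff {x y : ℤ → A} {i j : ℤ} {n : ℕ} :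
    block x i n = block y j n ↔ ∀ k : ℕ, k < n → x (i + k) = y (j + k) := by
  rw [block, block, List.ofFn_inj, funext_iff, Fin.forall_iff]

theorem block_add (x : ℤ → A) (i : ℤ) (m n : ℕ) :
    block x i (m + n) = block x i m ++ block x (i + m) n := by
  simp [block, List.ofFn_add, add_assoc]

theorem block_eq_append_iff {x : ℤ → A} {i : ℤ} {u v : List A} :
    block x i (u.length + v.length) = u ++ v ↔
      block x i u.length = u ∧ block x (i + u.length) v.length = v := by
  rw [block_add]
  exact ⟨fun h => List.append_inj h (by simp), fun h => congrArg₂ _ h.1 h.2⟩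

variable [TopologicalSpace A] {X : Subshift A ℤ}

theorem block_mem_language {x : ℤ → A} (hx : x ∈ X.carrier) (i : ℤ) (n : ℕ) :
    block x i n ∈ language X :=
  Set.mem_iUnion.2 ⟨n, x, hx, i, rfl⟩

theorem mem_language_of_block_eq {x : ℤ → A} (hx : x ∈ X.carrier) {i : ℤ} {n : ℕ} {w : List A}
    (h : block x i n = w) : w ∈ language X :=
  h ▸ block_mem_language hx i n

/-- By shift invariance, a word of `X` occurs at any prescribed position. -/
theorem exists_block_eq_of_mem_language {w : List A} (hw : w ∈ language X) (a : ℤ) :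
    ∃ x ∈ X.carrier, block x a w.length = w := by
  obtain ⟨n, x, hx, i, rfl⟩ := Set.mem_iUnion.1 hw
  refine ⟨shift (i - a) x, X.mapsTo _ hx, ?_⟩
  rw [length_block, block_eq_block_iff]
  intro k _
  rw [shift_apply]
  congr 1
  ring

/-- A sequence lies in `X` as soon as its blocks in a growing family of windows are words of `X`. -/
theorem mem_carrier_of_forall_block_mem_language [DiscreteTopology A] {z : ℤ → A} (a : ℤ) (c : ℕ)
    (h : ∀ N : ℕ, block z (a - N) (N + c + N) ∈ language X) : z ∈ X.carrier := by
  have h' (N : ℕ) : ∃ x ∈ X.carrier, block x (a - N) (N + c + N) = block z (a - N) (N + c + N) := by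
    simpa using exists_block_eq_of_mem_language (h N) (a - N)
  choose x hx hxz using h'
  refine X.isClosed.mem_of_tendsto (f := x) (b := Filter.atTop) ?_ (Filter.Eventually.of_forall hx)
  refine tendsto_pi_nhds.2 fun i => tendsto_const_nhds.congr' ?_
  filter_upwards [Filter.eventually_ge_atTop (i - a).natAbs.succ] with N hN
  have := block_eq_block_iff.1 (hxz N) (i - (a - N)).toNat (by omega)
  rw [show a - N + ((i - (a - N)).toNat : ℤ) = i by omega] at this
  exact this.symm

end Blocks

/-! ### Splicing at a synchronizing word -/

theorem IsSynchronizing.splice_mem {A : Type*} [TopologicalSpace A] [DiscreteTopology A]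
    {X : Subshift A ℤ} {s : List A} (hs : IsSynchronizing X s) {x y : ℤ → A}
    (hx : x ∈ X.carrier) (hy : y ∈ X.carrier) {a : ℤ}
    (hxs : block x a s.length = s) (hys : block y a s.length = s) :
    (fun i => if i < a then x i else y i) ∈ X.carrier := by
  refine mem_carrier_of_forall_block_mem_language a s.length fun N => ?_
  have hl : block x (a - N) N ++ s ∈ language X := by
    refine mem_language_of_block_eq hx (i := a - N) (n := N + s.length) ?_
    rw [block_add, sub_add_cancel, hxs]
  have hr : s ++ block y (a + s.length) N ∈ language X := by
    refine mem_language_of_block_eq hy (i := a) (n := s.length + N) ?_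
    rw [block_add, hys]
  convert hs.2 _ _ hl hr using 1
  rw [block_add, block_add, sub_add_cancel]
  congr 1
  · congr 1
    · refine block_eq_block_iff.2 fun k hk => if_pos ?_
      omega
    · refine Eq.trans (block_eq_block_iff.2 fun k hk => if_neg ?_) hys
      omega
  · rw [show a - (N : ℤ) + ((N + s.length : ℕ) : ℤ) = a + s.length by push_cast; ring]
    refine block_eq_block_iff.2 fun k hk => if_neg ?_
    omega

/-! ### Codes -/

section Codes

variable {A D : Type*} [TopologicalSpace A] [TopologicalSpace D]
  {X : Subshift A ℤ} {Y : Subshift D ℤ} {φ : X.carrier → Y.carrier}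

/-- The window `[-m, n]` determines the code: coordinates of images agree wherever the windows of the
arguments around them do. -/
theorem IsCode.exists_window (hφ : IsCode φ) :
    ∃ m n : ℤ, -m ≤ n ∧ ∀ (x y : X.carrier) (i j : ℤ),
      (∀ k : ℤ, -m ≤ k → k ≤ n → (x : ℤ → A) (i + k) = (y : ℤ → A) (j + k)) →
        (φ x : ℤ → D) i = (φ y : ℤ → D) j := by
  obtain ⟨m, n, hmn, Φ, hΦ⟩ := hφ
  refine ⟨m, n, hmn, fun x y i j h => ?_⟩
  rw [hΦ, hΦ]
  congr 2
  refine block_eq_block_iff.2 fun k hk => ?_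
  have := h (k - m) (by omega) (by omega)
  rwa [show i + ((k : ℤ) - m) = i - m + k by ring, show j + ((k : ℤ) - m) = j - m + k by ring]
    at this

theorem IsIrreducible.of_surjective (hX : IsIrreducible X) (hφ : IsCode φ)
    (hsurj : Function.Surjective φ) : IsIrreducible Y := by
  obtain ⟨m, n, hmn, hloc⟩ := hφ.exists_window
  obtain ⟨r, hr⟩ := Int.eq_ofNat_of_zero_le (show 0 ≤ m + n by omega)
  -- A block of `φ z` is determined by the block of `z` that is longer by `r = m + n`.
  have himage (x z : X.carrier) (i j : ℤ) (p : ℕ)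
      (h : block (z : ℤ → A) j (p + r) = block (x : ℤ → A) (i - m) (p + r)) :
      block (φ z : ℤ → D) (j + m) p = block (φ x : ℤ → D) i p := by
    refine block_eq_block_iff.2 fun k hk => hloc _ _ _ _ fun t ht₁ ht₂ => ?_
    have := block_eq_block_iff.1 h (k + t + m).toNat (by omega)
    rwa [show j + ((k + t + m).toNat : ℤ) = j + m + k + t by omega,
      show i - m + ((k + t + m).toNat : ℤ) = i + k + t by omega] at this
  intro u hu v hv
  obtain ⟨y, hy, hyu⟩ := exists_block_eq_of_mem_language hu 0
  obtain ⟨y', hy', hyv⟩ := exists_block_eq_of_mem_language hv 0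
  obtain ⟨x, hx⟩ := hsurj ⟨y, hy⟩
  obtain ⟨x', hx'⟩ := hsurj ⟨y', hy'⟩
  obtain ⟨w, -, hw⟩ := hX _ (block_mem_language x.2 (0 - m) (u.length + r)) _
    (block_mem_language x'.2 (0 - m) (v.length + r))
  obtain ⟨z, hz, hzw⟩ := exists_block_eq_of_mem_language hw 0
  rw [List.length_append, block_eq_append_iff, List.length_append, block_eq_append_iff] at hzw
  obtain ⟨⟨hzu, -⟩, hzv⟩ := hzw
  simp only [length_block] at hzu hzv
  have hu' := himage x ⟨z, hz⟩ 0 0 u.length hzu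
  have hv' := himage x' ⟨z, hz⟩ 0 _ v.length hzv
  rw [hx, hyu] at hu'
  rw [hx', hyv] at hv'
  refine ⟨block (φ ⟨z, hz⟩ : ℤ → D) (0 + m + u.length) (r + w.length),
    block_mem_language (φ ⟨z, hz⟩).2 _ _,
    mem_language_of_block_eq (φ ⟨z, hz⟩).2 (i := 0 + m)
      (n := u.length + (r + w.length) + v.length) ?_⟩
  rw [block_add, block_add, hu']
  congr 1
  convert hv' using 2
  push_cast
  ring

/-- If the central cylinder of `v` is covered by the image of the central cylinder of `u`, and `u`
starts with a synchronizing word and is long enough for the window `[-m, n]` to lie within the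
coordinates `[-l, l]` that it occupies, then `v` is synchronizing. -/
theorem isSynchronizing_of_centralCylinder_subset [DiscreteTopology A] {m n : ℤ}
    (hloc : ∀ (x y : X.carrier) (i j : ℤ),
      (∀ k : ℤ, -m ≤ k → k ≤ n → (x : ℤ → A) (i + k) = (y : ℤ → A) (j + k)) →
        (φ x : ℤ → D) i = (φ y : ℤ → D) j)
    {s t : List A} (hs : IsSynchronizing X s) {l : ℕ} (hl : (s ++ t).length = 2 * l + 1)
    (hm : m ≤ l) (hn : n ≤ l) {k : ℕ} {v : List D} (hv : v ∈ words Y (2 * k + 1))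
    (hsub : centralCylinder Y k v ⊆ φ '' centralCylinder X l (s ++ t)) :
    IsSynchronizing Y v := by
  have hvlen : v.length = 2 * k + 1 := by
    obtain ⟨y, -, i, rfl⟩ := hv
    simp
  refine ⟨Set.mem_iUnion.2 ⟨_, hv⟩, fun p q hp hq => ?_⟩
  -- Place `p ++ v` and `v ++ q` so that `v` occupies the central coordinates `[-k, k]`.
  obtain ⟨y, hy, hyv⟩ := exists_block_eq_of_mem_language hp (-k - p.length)
  obtain ⟨y', hy', hyv'⟩ := exists_block_eq_of_mem_language hq (-k)
  rw [List.length_append, block_eq_append_iff, sub_add_cancel] at hyv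
  rw [List.length_append, block_eq_append_iff] at hyv'
  obtain ⟨hyp, hyv⟩ := hyv
  obtain ⟨hyv', hyq⟩ := hyv'
  obtain ⟨x, hxu, hx⟩ := hsub (show (⟨y, hy⟩ : Y.carrier) ∈ centralCylinder Y k v by
    rw [centralCylinder, Set.mem_ofPred_eq, ← hvlen, hyv])
  obtain ⟨x', hxu', hx'⟩ := hsub (show (⟨y', hy'⟩ : Y.carrier) ∈ centralCylinder Y k v by
    rw [centralCylinder, Set.mem_ofPred_eq, ← hvlen, hyv'])
  rw [centralCylinder, Set.mem_ofPred_eq] at hxu hxu'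
  have hxx' (i : ℤ) (h₁ : -(l : ℤ) ≤ i) (h₂ : i ≤ l) : (x : ℤ → A) i = (x' : ℤ → A) i := by
    have := block_eq_block_iff.1 (hxu.trans hxu'.symm) (i + l).toNat (by omega)
    rwa [show -(l : ℤ) + ((i + l).toNat : ℤ) = i by omega] at this
  rw [← hl, List.length_append, block_eq_append_iff] at hxu hxu'
  let z : X.carrier := ⟨_, hs.splice_mem x.2 x'.2 hxu.1 hxu'.1⟩
  have hzx (i : ℤ) (h : i ≤ l) : (z : ℤ → A) i = (x : ℤ → A) i := by
    change (if i < -(l : ℤ) then (x : ℤ → A) i else (x' : ℤ → A) i) = (x : ℤ → A) i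
    split_ifs with hi
    · rfl
    · exact (hxx' i (not_lt.1 hi) h).symm
  have hzx' (i : ℤ) (h : -(l : ℤ) ≤ i) : (z : ℤ → A) i = (x' : ℤ → A) i :=
    if_neg (not_lt.2 h)
  -- The spliced point equals `x` on `(-∞, l]` and `x'` on `[-l, ∞)`, hence its image equals `y` on
  -- `(-∞, 0]` and `y'` on `[0, ∞)`.
  have hneg (i : ℤ) (h : i ≤ 0) : (φ z : ℤ → D) i = y i := by
    rw [hloc z x i i fun j _ hj => hzx _ (by omega), hx]
  have hpos (i : ℤ) (h : 0 ≤ i) : (φ z : ℤ → D) i = y' i := by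
    rw [hloc z x' i i fun j hj _ => hzx' _ (by omega), hx']
  refine mem_language_of_block_eq (φ z).2 (i := -k - p.length)
    (n := (p ++ v).length + q.length) ?_
  rw [block_eq_append_iff, List.length_append, block_eq_append_iff, sub_add_cancel]
  refine ⟨⟨?_, ?_⟩, ?_⟩
  · refine Eq.trans (block_eq_block_iff.2 fun j hj => hneg _ ?_) hyp
    omega
  · refine Eq.trans (block_eq_block_iff.2 fun j hj => ?_) hyv
    rcases le_total (-(k : ℤ) + j) 0 with h | h
    · exact hneg _ h
    · -- On the right half of `v` the points `y` and `y'` agree, since both carry `v` there.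
      rw [hpos _ h, block_eq_block_iff.1 (hyv'.trans hyv.symm) j hj]
  · rw [show -(k : ℤ) - p.length + ((p.length + v.length : ℕ) : ℤ) = -k + v.length by
      push_cast; ring]
    refine Eq.trans (block_eq_block_iff.2 fun j hj => hpos _ ?_) hyq
    omega

theorem IsSemiOpen.exists_isSynchronizing [DiscreteTopology A] (hφ : IsCode φ)
    (ho : IsSemiOpen φ) (hX : ∃ s, IsSynchronizing X s) : ∃ v, IsSynchronizing Y v := by
  obtain ⟨m, n, -, hloc⟩ := hφ.exists_window
  obtain ⟨s, hs⟩ := hX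
  obtain ⟨x, hx, hxs⟩ := exists_block_eq_of_mem_language hs.1 0
  let l : ℕ := s.length + m.natAbs + n.natAbs
  obtain ⟨r, hr⟩ : ∃ r, 2 * l + 1 = s.length + r := Nat.exists_eq_add_of_le (by omega)
  obtain ⟨k, hk⟩ := ho l
  have hu : block x 0 (2 * l + 1) = s ++ block x (0 + s.length) r := by
    rw [hr, block_add, hxs]
  obtain ⟨v, hv, hsub⟩ := hk _ ⟨x, hx, 0, rfl⟩
  rw [hu] at hsub
  exact ⟨v, isSynchronizing_of_centralCylinder_subset hloc hs (by rw [← hu, length_block])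
    (by omega) (by omega) hv hsub⟩

end Codes

end Shift

theorem theorem4p3 {A D : Type*}
    [Finite A] [TopologicalSpace A] [DiscreteTopology A]
    [Finite D] [TopologicalSpace D] [DiscreteTopology D]
    (X : Subshift A ℤ) (Y : Subshift D ℤ) (hX : Shift.IsSynchronized X)
    (φ : X.carrier → Y.carrier) (hφ : Shift.IsCode φ) :
    (Function.Surjective φ ∨ Shift.IsIrreducible Y →
      Shift.IsSemiOpen φ → Shift.IsSynchronized Y) ∧
    (Function.Surjective φ → ¬ Shift.IsSynchronized Y → ¬ Shift.IsSemiOpen φ) := by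
  have key (h : Function.Surjective φ ∨ Shift.IsIrreducible Y) (ho : Shift.IsSemiOpen φ) :
      Shift.IsSynchronized Y :=
    ⟨h.elim (hX.1.of_surjective hφ) id, ho.exists_isSynchronizing hφ hX.2⟩
  exact ⟨key, fun hsurj hY ho => hY (key (Or.inl hsurj) ho)⟩
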